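/- An axis-parallel rectangle in $\mathbb R^2$ is a product $I\times J$ of two (open, closed, half-open, possibly degenerate or unbounded) intervals. For a finite set $P$ of points and a finite set $B$ of rectangles in $\mathbb R^2$, let $G(P,B)$ be the bipartite incidence graph on $P\cup B$ in which $p\in P$ and $R\in B$ are adjacent iff $p\in R$, and let $I(P,B)$ be its number of edges. (1) For every $\varepsilon>0$ there is a constant $C=C(\varepsilon)>0$ such that for all integers $k\ge 1$, $n\ge 3$, $m\ge 0$, every set $P$ of $n$ points and every set $B$ of $m$ axis-parallel rectangles in $\mathbb R^2$ for which $G(P,B)$ does not contain $K_{k,k}$ as a subgraph, $$I(P,B)\le C\left(k\,n\,\frac{\log n}{\log\log n}+k\,m\,\log^{\varepsilon} n\right).$$ (2) For $m=n$ and constant $k\ge 2$ this is tight: there is a constant $c>0$ such that for all integers $k\ge 2$ and $n\ge 3$ there are a set $P$ of $n$ points and a set $B$ of $n$ closed axis-parallel rectangles $[a,b]\times[a',b']$ with $a<b$ and $a'<b'$ such that $G(P,B)$ does not contain $K_{k,k}$ and $$I(P,B)\ge c\,n\,\frac{\log n}{\log\log n}.$$ (For $m=n$, constant $k$ and $\varepsilon<1$,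 the upper bound in (1) is $O(n\log n/\log\log n)$.) -/

import Mathlib

/-- An axis-parallel rectangle in the plane: a Cartesian product of two intervals.
The intervals may be open, closed, half-open, degenerate or unbounded
(a subset of `ℝ` is an interval iff it is order-connected). -/
def IsRectangle (R : Set (ℝ × ℝ)) : Prop :=
  ∃ I J : Set ℝ, I.OrdConnected ∧ J.OrdConnected ∧ R = I ×ˢ J

/-- A rectangle `[a, b] × [c, d]` with `a < b` and `c < d`. -/
def IsClosedRectangle (R : Set (ℝ × ℝ)) : Prop :=
  ∃ a b c d : ℝ, a < b ∧ c < d ∧ R = Set.Icc a b ×ˢ Set.Icc c d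

theorem IsClosedRectangle.isRectangle {R : Set (ℝ × ℝ)} (h : IsClosedRectangle R) :
    IsRectangle R := by
  obtain ⟨a, b, c, d, -, -, rfl⟩ := h
  exact ⟨_, _, Set.ordConnected_Icc, Set.ordConnected_Icc, rfl⟩

/-- The incidence graph of a finite set `P` of points and a finite set `B` of objects in the
plane: the vertices are the points and the objects, and the edges are the pairs `p`, `b`
with `p ∈ b`. -/
def incidenceGraph (P : Finset (ℝ × ℝ)) (B : Finset (Set (ℝ × ℝ))) : SimpleGraph (P ⊕ B) where
  Adj
    | .inl p, .inr b => (p : ℝ × ℝ) ∈ (b : Set (ℝ × ℝ))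
    | .inr b, .inl p => (p : ℝ × ℝ) ∈ (b : Set (ℝ × ℝ))
    | _, _ => False
  symm := ⟨by rintro (p | b) (q | c) h <;> exact h⟩
  loopless := ⟨by rintro (p | b) h <;> exact h⟩

/-- The number of incidences between `P` and `B`: the number of edges of the incidence graph. -/
noncomputable def incidences (P : Finset (ℝ × ℝ)) (B : Finset (Set (ℝ × ℝ))) : ℕ :=
  (incidenceGraph P B).edgeSet.ncard

/-- The incidence graph of `P` and `B` does not contain `K_{k,k}` as a subgraph. -/
def IncidenceKFree (k : ℕ) (P : Finset (ℝ × ℝ)) (B : Finset (Set (ℝ × ℝ))) : Prop :=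
  (completeBipartiteGraph (Fin k) (Fin k)).Free (incidenceGraph P B)

/-!
Two bounds on the number of incidences between `n` points and `m` axis-parallel rectangles in the
plane whose incidence graph contains no `K_{k,k}`.

*Upper bound.* For three-sided rectangles the number of incidences is at most `2k(n + m)`
(`card_interedges_le_of_threeSided`). All rectangles through a lowest point `p` behave like
intervals around `p`, and those that contain at least `k` points on a given side of `p` have nested
traces on that side, so there are fewer than `k` of them. Hence either `p` lies in at most `2k`
rectangles, or some rectangle contains at most `2k` points, and one of the two can be deleted.

General rectangles are cut along a `B`-ary tree over the points sorted from left to right, where `B`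
is about `(log n) ^ ε`. A rectangle is assigned to the node at which the indices of its leftmost and
rightmost points separate. It meets at most `B` children of that node, and within each of them it is
three-sided, the open side being a vertical side of the block. Each of the `O(log n / log (log n))`
levels contributes `O(k n)` for the points, and each rectangle contributes `O(k B)` in total
(`card_interedges_le_of_tree`).

*Lower bound.* Identify `N < b ^ r` with its `r` base-`b` digits, and put `N` at the point whose
ordinate is `N` and whose abscissa is the number with the digits reversed. The `b` points that agree
in all digits but the `j`-th, that is, an axis-parallel line of the grid `[b] ^ r`, are cut out by a
rectangle: the high digits confine the ordinate to an interval, and the low digits confine the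
abscissa. Two grid lines share at most one point, so there is no `K_{2,2}`; each point lies on `r`
lines, and there are `r * b ^ (r - 1)` lines. With `r = b` there are as many lines as points
(`exists_rectangles_of_pow_le`), and `b` is of order `log n / log (log n)` (`exists_pow_self_le`).
For `n` that is not of the form `b ^ b`, copies of this configuration are stacked vertically.
-/

/-! ### Biclique-free relations -/

section BicliqueFree

open scoped Classical

variable {α ι : Type*}

/-- The relation `r`, seen as a bipartite graph between the finite sets `S` and `T`, contains no
biclique with `k` vertices from `S` and `k` vertices from `T`. -/
def BicliqueFree (k : ℕ) (r : α → ι → Prop) (S : Finset α) (T : Finset ι) : Prop :=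
  ∀ S' ⊆ S, ∀ T' ⊆ T, S'.card = k → T'.card = k → ∃ i ∈ S', ∃ b ∈ T', ¬ r i b

theorem BicliqueFree.mono {k : ℕ} {r : α → ι → Prop} {S S' : Finset α} {T T' : Finset ι}
    (h : BicliqueFree k r S T) (hS : S' ⊆ S) (hT : T' ⊆ T) : BicliqueFree k r S' T' :=
  fun A hA C hC => h A (hA.trans hS) C (hC.trans hT)

/-- If `k` objects each contain at least `k` points on the lower side of `p`, and together with a
point contain everything between it and `p`, then their traces on that side are nested, and the
smallest trace spans a biclique. -/
theorem not_bicliqueFree_of_nested {k : ℕ} (hk : 1 ≤ k) {r : α → ι → Prop} {S : Finset α}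
    {T : Finset ι} (y : α → ℝ) (v : ℝ)
    (hr : ∀ b ∈ T, ∀ i ∈ S, ∀ j ∈ S, r j b → y j ≤ y i → y i ≤ v → r i b)
    (hT : k ≤ T.card) (hcard : ∀ b ∈ T, k ≤ (S.filter fun i => r i b ∧ y i ≤ v).card) :
    ¬ BicliqueFree k r S T := by
  intro hfree
  have hne : T.Nonempty := Finset.card_pos.mp (by omega)
  obtain ⟨b₀, hb₀, hmin⟩ :=
    Finset.exists_min_image T (fun b => (S.filter fun i => r i b ∧ y i ≤ v).card) hne
  have hsub : ∀ b ∈ T, ∀ i ∈ S.filter (fun i => r i b₀ ∧ y i ≤ v), r i b := by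
    intro b hb i hi
    by_contra hnot
    rw [Finset.mem_filter] at hi
    -- otherwise the trace of `b` would be a proper subset of the smallest trace
    have : S.filter (fun i => r i b ∧ y i ≤ v) ⊂ S.filter (fun i => r i b₀ ∧ y i ≤ v) := by
      rw [Finset.ssubset_iff_of_subset]
      · exact ⟨i, by simpa using hi, by simp [hnot]⟩
      · intro j hj
        rw [Finset.mem_filter] at hj ⊢
        refine ⟨hj.1, hr b₀ hb₀ j hj.1 i hi.1 hi.2.1 ?_ hj.2.2, hj.2.2⟩
        by_contra hlt
        exact hnot (hr b hb i hi.1 j hj.1 hj.2.1 (not_le.mp hlt).le hi.2.2)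
    exact absurd (Finset.card_lt_card this) (not_lt.mpr (hmin b hb))
  obtain ⟨S', hS', hS'k⟩ := Finset.exists_subset_card_eq (hcard b₀ hb₀)
  obtain ⟨T', hT', hT'k⟩ := Finset.exists_subset_card_eq hT
  obtain ⟨i, hi, b, hb, hnot⟩ :=
    hfree S' (hS'.trans (Finset.filter_subset _ _)) T' hT' hS'k hT'k
  exact hnot (hsub b (hT' hb) i (hS' hi))

/-- A linear bound for three-sided rectangles. The hypothesis `hr` says that an object containing
`p` and `j` contains every point that is at least as high as `p` and horizontally between `p` and
`j`; here `h` is the height and `y` the horizontal coordinate.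

The incidence graph is `2k`-degenerate: if every object contains more than `2k` points, then each
object through a lowest point `p` contains at least `k` points on one of the two sides of `p`, so
that more than `2k` objects through `p` would give a biclique on one side. -/
theorem card_interedges_le_of_threeSided {k : ℕ} (hk : 1 ≤ k) {r : α → ι → Prop}
    {S : Finset α} {T : Finset ι} (h : α → ℤ) (y : α → ℝ)
    (hr : ∀ b ∈ T, ∀ p ∈ S, ∀ j ∈ S, ∀ i ∈ S, r p b → r j b → h p ≤ h i →
      y i ∈ Set.uIcc (y j) (y p) → r i b)
    (hfree : BicliqueFree k r S T) :
    (Rel.interedges r S T).card ≤ 2 * k * (S.card + T.card) := by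
  obtain ⟨N, hN⟩ : ∃ N, S.card + T.card = N := ⟨_, rfl⟩
  induction N generalizing S T with
  | zero =>
    have : S = ∅ := Finset.card_eq_zero.mp (by omega)
    simp [this]
  | succ N ih =>
    rcases S.eq_empty_or_nonempty with rfl | hS
    · simp
    obtain ⟨p, hp, hmin⟩ := Finset.exists_min_image S h hS
    by_cases hB : ∃ b ∈ T, (S.filter fun i => r i b).card ≤ 2 * k
    · obtain ⟨b, hb, hdeg⟩ := hB
      have hc : (T.erase b).card + 1 = T.card := Finset.card_erase_add_one hb
      have key := ih (S := S) (T := T.erase b)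
        (fun b' hb' => hr b' (Finset.mem_of_mem_erase hb'))
        (hfree.mono subset_rfl (Finset.erase_subset _ _)) (by omega)
      have hsub : Rel.interedges r S T ⊆
          Rel.interedges r S (T.erase b) ∪ (S.filter fun i => r i b).image (fun i => (i, b)) := by
        rintro ⟨i, b'⟩ hx
        rw [Rel.mem_interedges_iff] at hx
        by_cases hbb : b' = b
        · subst hbb
          simp [hx.1, hx.2.2]
        · simp [Rel.mem_interedges_iff, hx.1, hx.2.1, hx.2.2, hbb]
      calc (Rel.interedges r S T).card
          ≤ _ := (Finset.card_le_card hsub).trans (Finset.card_union_le _ _)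
        _ ≤ 2 * k * (S.card + (T.erase b).card) + 2 * k :=
          add_le_add key (Finset.card_image_le.trans hdeg)
        _ = 2 * k * (S.card + T.card) := by rw [← hc]; ring
    by_cases hP : (T.filter fun b => r p b).card ≤ 2 * k
    · have hc : (S.erase p).card + 1 = S.card := Finset.card_erase_add_one hp
      have key := ih (S := S.erase p) (T := T)
        (fun b hb q hq j hj i hi => hr b hb q (Finset.mem_of_mem_erase hq) j
          (Finset.mem_of_mem_erase hj) i (Finset.mem_of_mem_erase hi))
        (hfree.mono (Finset.erase_subset _ _) subset_rfl) (by omega)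
      have hsub : Rel.interedges r S T ⊆
          Rel.interedges r (S.erase p) T ∪ (T.filter fun b => r p b).image (fun b => (p, b)) := by
        rintro ⟨i, b⟩ hx
        rw [Rel.mem_interedges_iff] at hx
        by_cases hii : i = p
        · subst hii
          simp [hx.2.1, hx.2.2]
        · simp [Rel.mem_interedges_iff, hx.1, hx.2.1, hx.2.2, hii]
      calc (Rel.interedges r S T).card
          ≤ _ := (Finset.card_le_card hsub).trans (Finset.card_union_le _ _)
        _ ≤ 2 * k * ((S.erase p).card + T.card) + 2 * k :=
          add_le_add key (Finset.card_image_le.trans hP)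
        _ = 2 * k * (S.card + T.card) := by rw [← hc]; ring
    exfalso
    push Not at hB hP
    let TL := T.filter fun b => r p b ∧ k ≤ (S.filter fun i => r i b ∧ y i ≤ y p).card
    let TR := T.filter fun b => r p b ∧ k ≤ (S.filter fun i => r i b ∧ -y i ≤ -y p).card
    have hcover : (T.filter fun b => r p b) ⊆ TL ∪ TR := by
      intro b hb
      rw [Finset.mem_filter] at hb
      have hsub : S.filter (fun i => r i b) ⊆
          S.filter (fun i => r i b ∧ y i ≤ y p) ∪ S.filter (fun i => r i b ∧ -y i ≤ -y p) := by
        intro i hi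
        rw [Finset.mem_filter] at hi
        rcases le_total (y i) (y p) with h1 | h1 <;> simp [hi.1, hi.2, h1]
      have h1 := (Finset.card_le_card hsub).trans (Finset.card_union_le _ _)
      have h2 := hB b hb.1
      rw [Finset.mem_union, Finset.mem_filter, Finset.mem_filter]
      by_cases h3 : k ≤ (S.filter fun i => r i b ∧ y i ≤ y p).card
      · exact Or.inl ⟨hb.1, hb.2, h3⟩
      · exact Or.inr ⟨hb.1, hb.2, by omega⟩
    have hcard := (Finset.card_le_card hcover).trans (Finset.card_union_le _ _)
    rcases Nat.lt_or_ge TL.card k with hL | hL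
    · have hTR : TR ⊆ T := Finset.filter_subset _ _
      refine not_bicliqueFree_of_nested hk (T := TR) (fun i => -y i) (-y p) ?_ (by omega) ?_
        (hfree.mono subset_rfl hTR)
      · intro b hb i hi j hj hjb h1 h2
        rw [Finset.mem_filter] at hb
        refine hr b hb.1 p hp j hj i hi hb.2.1 hjb (hmin i hi) ?_
        rw [Set.uIcc_of_ge (by linarith)]
        exact ⟨by linarith, by linarith⟩
      · exact fun b hb => (Finset.mem_filter.mp hb).2.2
    · have hTL : TL ⊆ T := Finset.filter_subset _ _
      refine not_bicliqueFree_of_nested hk (T := TL) y (y p) ?_ hL ?_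
        (hfree.mono subset_rfl hTL)
      · intro b hb i hi j hj hjb h1 h2
        rw [Finset.mem_filter] at hb
        refine hr b hb.1 p hp j hj i hi hb.2.1 hjb (hmin i hi) ?_
        rw [Set.uIcc_of_le (by linarith)]
        exact ⟨h1, h2⟩
      · exact fun b hb => (Finset.mem_filter.mp hb).2.2

end BicliqueFree

/-! ### Rectangles and the tree of blocks -/

section Blocks

open scoped Classical

variable {α ι : Type*}

/-- The level of a pair of indices: the least `l` for which the block of length `B ^ l` that
contains `u` also contains `v` (and `0` if there is none). -/
noncomputable def blockLevel (B u v : ℕ) : ℕ := sInf {l | u / B ^ l = v / B ^ l}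

theorem div_pow_ne_of_lt_blockLevel {B u v l : ℕ} (h : l < blockLevel B u v) :
    u / B ^ l ≠ v / B ^ l :=
  Nat.notMem_of_lt_sInf (s := {l | u / B ^ l = v / B ^ l}) h

theorem div_pow_blockLevel {B u v L : ℕ} (hu : u < B ^ L) (hv : v < B ^ L) :
    u / B ^ blockLevel B u v = v / B ^ blockLevel B u v :=
  Nat.sInf_mem (s := {l | u / B ^ l = v / B ^ l})
    ⟨L, by simp [Nat.div_eq_of_lt hu, Nat.div_eq_of_lt hv]⟩

theorem blockLevel_le {B u v L : ℕ} (hu : u < B ^ L) (hv : v < B ^ L) : blockLevel B u v ≤ L :=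
  Nat.sInf_le (by simp [Nat.div_eq_of_lt hu, Nat.div_eq_of_lt hv])

/-- A range of indices from `u` to `v` is assigned to one level `l`, and it meets at most `B` blocks
of length `B ^ l`, since they all lie in one block of length `B ^ (l + 1)`. -/
theorem card_blocks_le {B u v L n : ℕ} (hu : u < B ^ L) (hv : v < B ^ L) :
    ((Finset.range L ×ˢ Finset.range n).filter fun x : ℕ × ℕ => blockLevel B u v = x.1 + 1 ∧
      u / B ^ x.1 ≤ x.2 ∧ x.2 ≤ v / B ^ x.1).card ≤ B := by
  rcases Nat.eq_zero_or_pos (blockLevel B u v) with h0 | h0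
  · rw [Finset.filter_false_of_mem (by rintro x - ⟨h, -⟩; omega)]
    simp
  obtain ⟨l, hl⟩ : ∃ l, blockLevel B u v = l + 1 := ⟨_, (Nat.sub_add_cancel h0).symm⟩
  have hdiv := div_pow_blockLevel hu hv
  rw [hl, pow_succ, ← Nat.div_div_eq_div_mul, ← Nat.div_div_eq_div_mul] at hdiv
  have hB : 0 < B := by
    rcases Nat.eq_zero_or_pos B with rfl | h
    · rcases Nat.eq_zero_or_pos L with rfl | hL
      · simp only [pow_zero, Nat.lt_one_iff] at hu hv
        subst hu hv
        exact absurd rfl (div_pow_ne_of_lt_blockLevel h0)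
      · simp [hL.ne'] at hu
    · exact h
  have hlt : v / B ^ l < u / B ^ l + B := by
    have h1 := Nat.div_add_mod (v / B ^ l) B
    have h2 := Nat.div_add_mod (u / B ^ l) B
    have h3 := Nat.mod_lt (v / B ^ l) hB
    rw [← hdiv] at h1
    omega
  calc _ ≤ ((Finset.Ico (u / B ^ l) (u / B ^ l + B)).image fun q => (l, q)).card := by
        refine Finset.card_le_card ?_
        rintro ⟨l', q⟩ hx
        rw [Finset.mem_filter] at hx
        obtain ⟨-, h1, h2, h3⟩ := hx
        obtain rfl : l' = l := by simp only at h1; omega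
        simp only at h2 h3
        simp only [Finset.mem_image, Finset.mem_Ico, Prod.mk.injEq, true_and, exists_eq_right]
        omega
    _ ≤ _ := Finset.card_image_le
    _ = B := by simp

/-- The contribution of one type of three-sided pieces: each level contributes `2 * k * n` for the
points, and each object is counted for at most `B` blocks. -/
theorem sum_blocks_le {k B L n : ℕ} {r : α → ι → Prop} {S : Finset α} {T : Finset ι}
    (idx : α → ℕ) (lo hi : ι → ℕ) (hidx : ∀ p ∈ S, idx p < n) (hS : S.card ≤ n)
    (hlo : ∀ b ∈ T, lo b < B ^ L) (hhi : ∀ b ∈ T, hi b < B ^ L) (U : ℕ × ℕ → Finset ι)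
    (hUT : ∀ x, U x ⊆ T)
    (hU : ∀ x, ∀ b ∈ U x, blockLevel B (lo b) (hi b) = x.1 + 1 ∧
      lo b / B ^ x.1 ≤ x.2 ∧ x.2 ≤ hi b / B ^ x.1)
    (hbound : ∀ x, (Rel.interedges r (S.filter fun p => idx p / B ^ x.1 = x.2) (U x)).card ≤
      2 * k * ((S.filter fun p => idx p / B ^ x.1 = x.2).card + (U x).card)) :
    ∑ x ∈ Finset.range L ×ˢ Finset.range n,
      (Rel.interedges r (S.filter fun p => idx p / B ^ x.1 = x.2) (U x)).card ≤
      2 * k * (L * n + B * T.card) := by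
  have h1 : ∑ x ∈ Finset.range L ×ˢ Finset.range n,
      (S.filter fun p => idx p / B ^ x.1 = x.2).card ≤ L * n := by
    rw [Finset.sum_product]
    refine (Finset.sum_le_card_nsmul _ _ n fun l _ => ?_).trans (by simp)
    refine (Finset.card_eq_sum_card_fiberwise (f := fun p => idx p / B ^ l) ?_).symm.le.trans hS
    intro p hp
    simpa using (Nat.div_le_self _ _).trans_lt (hidx p hp)
  have h2 : ∑ x ∈ Finset.range L ×ˢ Finset.range n, (U x).card ≤ B * T.card := by
    have hflt : ∀ x, U x = T.filter fun b => b ∈ U x := by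
      intro x
      ext b
      simpa using fun hb => hUT x hb
    have hswap := Finset.sum_card_bipartiteAbove_eq_sum_card_bipartiteBelow
      (fun (x : ℕ × ℕ) b => b ∈ U x) (s := Finset.range L ×ˢ Finset.range n) (t := T)
    calc ∑ x ∈ Finset.range L ×ˢ Finset.range n, (U x).card
        = ∑ x ∈ Finset.range L ×ˢ Finset.range n, (T.filter fun b => b ∈ U x).card :=
          Finset.sum_congr rfl fun x _ => by rw [← hflt x]
      _ = ∑ b ∈ T, ((Finset.range L ×ˢ Finset.range n).filter fun x => b ∈ U x).card := hswap
      _ ≤ ∑ _b ∈ T, B := by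
          refine Finset.sum_le_sum fun b hb => ?_
          refine (Finset.card_le_card ?_).trans (card_blocks_le (n := n) (hlo b hb) (hhi b hb))
          intro x hx
          rw [Finset.mem_filter] at hx ⊢
          exact ⟨hx.1, hU x b hx.2⟩
      _ = B * T.card := by simp [mul_comm]
  calc _ ≤ ∑ x ∈ Finset.range L ×ˢ Finset.range n,
        2 * k * ((S.filter fun p => idx p / B ^ x.1 = x.2).card + (U x).card) :=
        Finset.sum_le_sum fun x _ => hbound x
    _ ≤ _ := by
        rw [← Finset.mul_sum, Finset.sum_add_distrib]
        gcongr

/-- The bound for rectangles in terms of the fan-out `B` and the depth `L` of a `B`-ary tree over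
the horizontal order `idx` of the points. The rectangle `b` consists of the points with index in
`[lo b, hi b]` and ordinate in `J b`. At the level to which it is assigned, it leaves every block
that it meets through the right end (`U`) or the left end (`D`), so that it is three-sided there,
with `idx` or `-idx` as the height. -/
theorem card_interedges_le_of_tree {k B L n : ℕ} (hk : 1 ≤ k) {r : α → ι → Prop}
    {S : Finset α} {T : Finset ι} (idx : α → ℕ) (y : α → ℝ) (lo hi : ι → ℕ) (J : ι → Set ℝ)
    (hinj : Set.InjOn idx S) (hidx : ∀ p ∈ S, idx p < n) (hS : S.card ≤ n)
    (hlo : ∀ b ∈ T, lo b < B ^ L) (hhi : ∀ b ∈ T, hi b < B ^ L)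
    (hJ : ∀ b ∈ T, (J b).OrdConnected)
    (hr : ∀ p ∈ S, ∀ b ∈ T, r p b ↔ lo b ≤ idx p ∧ idx p ≤ hi b ∧ y p ∈ J b)
    (hfree : BicliqueFree k r S T) :
    (Rel.interedges r S T).card ≤ T.card + 4 * k * (L * n + B * T.card) := by
  let V : ℕ × ℕ → Finset α := fun x => S.filter fun p => idx p / B ^ x.1 = x.2
  let U : ℕ × ℕ → Finset ι := fun x => T.filter fun b =>
    blockLevel B (lo b) (hi b) = x.1 + 1 ∧ lo b / B ^ x.1 ≤ x.2 ∧ x.2 < hi b / B ^ x.1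
  let D : ℕ × ℕ → Finset ι := fun x => T.filter fun b =>
    blockLevel B (lo b) (hi b) = x.1 + 1 ∧ lo b / B ^ x.1 < x.2 ∧ x.2 = hi b / B ^ x.1
  have hVS : ∀ x, V x ⊆ S := fun x => Finset.filter_subset _ _
  have hUT : ∀ x, U x ⊆ T := fun x => Finset.filter_subset _ _
  have hDT : ∀ x, D x ⊆ T := fun x => Finset.filter_subset _ _
  have hUb : ∀ x, (Rel.interedges r (V x) (U x)).card ≤ 2 * k * ((V x).card + (U x).card) := by
    intro x
    refine card_interedges_le_of_threeSided hk (fun p => (idx p : ℤ)) y ?_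
      (hfree.mono (hVS x) (hUT x))
    intro b hb p hp j hj i hi' hpb hjb hpi hy
    have hbT := hUT x hb
    rw [hr _ (hVS x hp) _ hbT] at hpb
    rw [hr _ (hVS x hj) _ hbT] at hjb
    rw [hr _ (hVS x hi') _ hbT]
    refine ⟨hpb.1.trans (by exact_mod_cast hpi), ?_, (hJ b hbT).uIcc_subset hjb.2.2 hpb.2.2 hy⟩
    by_contra hlt
    have h1 := Nat.div_le_div_right (c := B ^ x.1) (not_le.mp hlt).le
    have h2 := (Finset.mem_filter.mp hi').2
    have h3 := (Finset.mem_filter.mp hb).2.2.2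
    omega
  have hDb : ∀ x, (Rel.interedges r (V x) (D x)).card ≤ 2 * k * ((V x).card + (D x).card) := by
    intro x
    refine card_interedges_le_of_threeSided hk (fun p => -(idx p : ℤ)) y ?_
      (hfree.mono (hVS x) (hDT x))
    intro b hb p hp j hj i hi' hpb hjb hpi hy
    have hbT := hDT x hb
    rw [hr _ (hVS x hp) _ hbT] at hpb
    rw [hr _ (hVS x hj) _ hbT] at hjb
    rw [hr _ (hVS x hi') _ hbT]
    refine ⟨?_, le_trans (by simpa using hpi) hpb.2.1,
      (hJ b hbT).uIcc_subset hjb.2.2 hpb.2.2 hy⟩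
    by_contra hlt
    have h1 := Nat.div_le_div_right (c := B ^ x.1) (not_le.mp hlt).le
    have h2 := (Finset.mem_filter.mp hi').2
    have h3 := (Finset.mem_filter.mp hb).2.2.1
    omega
  have hUsum := sum_blocks_le idx lo hi hidx hS hlo hhi U hUT
    (fun x b hb => ⟨(Finset.mem_filter.mp hb).2.1, (Finset.mem_filter.mp hb).2.2.1,
      (Finset.mem_filter.mp hb).2.2.2.le⟩) hUb
  have hDsum := sum_blocks_le idx lo hi hidx hS hlo hhi D hDT
    (fun x b hb => ⟨(Finset.mem_filter.mp hb).2.1, (Finset.mem_filter.mp hb).2.2.1.le,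
      (Finset.mem_filter.mp hb).2.2.2.le⟩) hDb
  -- a rectangle of level zero spans a single index and contains at most one point
  let Z := (Rel.interedges r S T).filter fun x => blockLevel B (lo x.2) (hi x.2) = 0
  have hZ : Z.card ≤ T.card := by
    refine Finset.card_le_card_of_injOn Prod.snd (fun x hx => ?_) ?_
    · exact (Rel.mem_interedges_iff.mp (Finset.mem_filter.mp hx).1).2.1
    · rintro ⟨p, b⟩ hx ⟨q, b'⟩ hx' (rfl : b = b')
      obtain ⟨h1, h2⟩ := Finset.mem_filter.mp hx
      obtain ⟨h1', -⟩ := Finset.mem_filter.mp hx'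
      rw [Rel.mem_interedges_iff] at h1 h1'
      simp only at h1 h1' h2
      have hp := (hr _ h1.1 _ h1.2.1).mp h1.2.2
      have hq := (hr _ h1'.1 _ h1'.2.1).mp h1'.2.2
      have h3 := div_pow_blockLevel (hlo b h1.2.1) (hhi b h1.2.1)
      rw [h2] at h3
      simp only [pow_zero, Nat.div_one] at h3
      rw [hinj h1.1 h1'.1 (by omega)]
  have hcover : Rel.interedges r S T ⊆ Z ∪
      ((Finset.range L ×ˢ Finset.range n).biUnion (fun x => Rel.interedges r (V x) (U x)) ∪
      (Finset.range L ×ˢ Finset.range n).biUnion (fun x => Rel.interedges r (V x) (D x))) := by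
    rintro ⟨p, b⟩ hx
    have hx' := Rel.mem_interedges_iff.mp hx
    obtain ⟨hp, hb, hpb⟩ := hx'
    simp only at hp hb hpb
    have hpb' := (hr _ hp _ hb).mp hpb
    rcases Nat.eq_zero_or_pos (blockLevel B (lo b) (hi b)) with h0 | h0
    · exact Finset.mem_union_left _ (Finset.mem_filter.mpr ⟨hx, h0⟩)
    refine Finset.mem_union_right _ ?_
    obtain ⟨l, hl⟩ : ∃ l, blockLevel B (lo b) (hi b) = l + 1 := ⟨_, (Nat.sub_add_cancel h0).symm⟩
    have hlL : l < L := by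
      have := blockLevel_le (hlo b hb) (hhi b hb)
      omega
    have hne := div_pow_ne_of_lt_blockLevel (l := l) (by omega : l < blockLevel B (lo b) (hi b))
    have hle1 := Nat.div_le_div_right (c := B ^ l) hpb'.1
    have hle2 := Nat.div_le_div_right (c := B ^ l) hpb'.2.1
    have hmem : (l, idx p / B ^ l) ∈ Finset.range L ×ˢ Finset.range n := by
      simpa [hlL] using (Nat.div_le_self _ _).trans_lt (hidx p hp)
    have hV : p ∈ V (l, idx p / B ^ l) := Finset.mem_filter.mpr ⟨hp, rfl⟩
    by_cases hq : idx p / B ^ l < hi b / B ^ l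
    · refine Finset.mem_union_left _ (Finset.mem_biUnion.mpr ⟨_, hmem, ?_⟩)
      exact Rel.mem_interedges_iff.mpr ⟨hV, Finset.mem_filter.mpr ⟨hb, hl, hle1, hq⟩, hpb⟩
    · refine Finset.mem_union_right _ (Finset.mem_biUnion.mpr ⟨_, hmem, ?_⟩)
      refine Rel.mem_interedges_iff.mpr ⟨hV, Finset.mem_filter.mpr ⟨hb, hl, ?_, ?_⟩, hpb⟩ <;>
        simp only <;> omega
  calc (Rel.interedges r S T).card
      ≤ Z.card + (∑ x ∈ Finset.range L ×ˢ Finset.range n, (Rel.interedges r (V x) (U x)).card +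
        ∑ x ∈ Finset.range L ×ˢ Finset.range n, (Rel.interedges r (V x) (D x)).card) :=
        (Finset.card_le_card hcover).trans <| (Finset.card_union_le _ _).trans <|
          Nat.add_le_add_left ((Finset.card_union_le _ _).trans
            (Nat.add_le_add Finset.card_biUnion_le Finset.card_biUnion_le)) _
    _ ≤ T.card + (2 * k * (L * n + B * T.card) + 2 * k * (L * n + B * T.card)) :=
        Nat.add_le_add hZ (Nat.add_le_add hUsum hDsum)
    _ = _ := by ring

end Blocks

/-! ### The incidence graph -/

section Incidence

open scoped Classical

theorem incidences_eq_card_interedges (P : Finset (ℝ × ℝ)) (B : Finset (Set (ℝ × ℝ))) :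
    incidences P B = (Rel.interedges (fun (p : ℝ × ℝ) (R : Set (ℝ × ℝ)) => p ∈ R) P B).card := by
  rw [incidences, ← Set.ncard_coe_finset]
  symm
  refine Set.ncard_congr (fun x hx => s(Sum.inl ⟨x.1, (Rel.mem_interedges_iff.mp hx).1⟩,
    Sum.inr ⟨x.2, (Rel.mem_interedges_iff.mp hx).2.1⟩)) ?_ ?_ ?_
  · intro x hx
    exact (Rel.mem_interedges_iff.mp hx).2.2
  · intro x x' hx hx' h
    simpa [Prod.ext_iff] using h
  · intro e he
    induction e using Sym2.ind with
    | _ u v =>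
      rw [SimpleGraph.mem_edgeSet] at he
      rcases u with p | R <;> rcases v with q | Q
      · exact he.elim
      · exact ⟨(p, Q), Rel.mem_interedges_iff.mpr ⟨p.2, Q.2, he⟩, rfl⟩
      · exact ⟨(q, R), Rel.mem_interedges_iff.mpr ⟨q.2, R.2, he⟩, Sym2.eq_swap⟩
      · exact he.elim

theorem IncidenceKFree.bicliqueFree {k : ℕ} {P : Finset (ℝ × ℝ)} {B : Finset (Set (ℝ × ℝ))}
    (h : IncidenceKFree k P B) :
    BicliqueFree k (fun (p : ℝ × ℝ) (R : Set (ℝ × ℝ)) => p ∈ R) P B := by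
  intro S hS T hT hSk hTk
  by_contra! hcon
  refine h ⟨⟨⟨Sum.map (fun i => ⟨_, hS ((S.equivFinOfCardEq hSk).symm i).2⟩)
    (fun i => ⟨_, hT ((T.equivFinOfCardEq hTk).symm i).2⟩), ?_⟩, ?_⟩⟩
  · rintro (i | i) (j | j) hij
    · simp at hij
    · exact hcon _ (Finset.coe_mem _) _ (Finset.coe_mem _)
    · exact hcon _ (Finset.coe_mem _) _ (Finset.coe_mem _)
    · simp at hij
  · refine Function.Injective.sumMap ?_ ?_ <;>
    · intro i j hij
      simpa [Subtype.ext_iff] using hij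

/-- If two distinct points never lie in two distinct objects, then the incidence graph contains no
`K_{k,k}` for `k ≥ 2`. -/
theorem incidenceKFree_of_pairwise {k : ℕ} (hk : 2 ≤ k) {P : Finset (ℝ × ℝ)}
    {B : Finset (Set (ℝ × ℝ))}
    (h : ∀ p ∈ P, ∀ q ∈ P, ∀ R ∈ B, ∀ Q ∈ B, p ∈ R → q ∈ R → p ∈ Q → q ∈ Q → p = q ∨ R = Q) :
    IncidenceKFree k P B := by
  rintro ⟨f, hf⟩
  let a : Fin k := ⟨0, by omega⟩
  let b : Fin k := ⟨1, by omega⟩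
  have hab : a ≠ b := by simp [a, b]
  have hadj : ∀ i j : Fin k, (incidenceGraph P B).Adj (f (Sum.inl i)) (f (Sum.inr j)) :=
    fun i j => f.map_adj (by simp)
  have h1 : f (Sum.inl a) ≠ f (Sum.inl b) := fun he => hab (by simpa using hf he)
  have h2 : f (Sum.inr a) ≠ f (Sum.inr b) := fun he => hab (by simpa using hf he)
  have haa := hadj a a
  have hab' := hadj a b
  have hba := hadj b a
  have hbb := hadj b b
  generalize f (Sum.inl a) = u at *
  generalize f (Sum.inl b) = v at *
  generalize f (Sum.inr a) = w at *
  generalize f (Sum.inr b) = z at *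
  rcases u with p | p <;> rcases w with R | R <;> first | exact haa.elim | skip
  all_goals rcases v with q | q <;> first | exact hba.elim | skip
  all_goals rcases z with Q | Q <;> first | exact hab'.elim | skip
  · rcases h p p.2 q q.2 R R.2 Q Q.2 haa hba hab' hbb with h3 | h3
    · exact h1 (by rw [Subtype.ext h3])
    · exact h2 (by rw [Subtype.ext h3])
  · rcases h R R.2 Q Q.2 p p.2 q q.2 haa hab' hba hbb with h3 | h3
    · exact h2 (by rw [Subtype.ext h3])
    · exact h1 (by rw [Subtype.ext h3])

end Incidence

/-! ### The upper bound -/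

section UpperBound

open scoped Classical

/-- The rank of `p` among the points of `P`, ordered from left to right with ties broken by the
ordinate. -/
noncomputable def lexRank (P : Finset (ℝ × ℝ)) (p : ℝ × ℝ) : ℕ :=
  (P.filter fun q => toLex q < toLex p).card

theorem lexRank_lt_lexRank {P : Finset (ℝ × ℝ)} {p q : ℝ × ℝ} (hp : p ∈ P)
    (h : toLex p < toLex q) : lexRank P p < lexRank P q := by
  refine Finset.card_lt_card ((Finset.ssubset_iff_of_subset ?_).mpr ⟨p, by simp [hp, h], by simp⟩)
  intro z hz
  rw [Finset.mem_filter] at hz ⊢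
  exact ⟨hz.1, hz.2.trans h⟩

theorem lexRank_injOn (P : Finset (ℝ × ℝ)) : Set.InjOn (lexRank P) P := by
  intro p hp q hq h
  rcases lt_trichotomy (toLex p) (toLex q) with h1 | h1 | h1
  · exact absurd h (lexRank_lt_lexRank hp h1).ne
  · exact toLex.injective h1
  · exact absurd h (lexRank_lt_lexRank hq h1).ne'

theorem lexRank_lt_card {P : Finset (ℝ × ℝ)} {p : ℝ × ℝ} (hp : p ∈ P) :
    lexRank P p < P.card :=
  Finset.card_lt_card
    ((Finset.ssubset_iff_of_subset (Finset.filter_subset _ _)).mpr ⟨p, hp, by simp⟩)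

theorem fst_le_fst_of_lexRank_le {P : Finset (ℝ × ℝ)} {p q : ℝ × ℝ} (hq : q ∈ P)
    (h : lexRank P p ≤ lexRank P q) : p.1 ≤ q.1 := by
  by_contra! hlt
  exact absurd (lexRank_lt_lexRank hq (Prod.Lex.toLex_lt_toLex.mpr (Or.inl hlt))) (not_lt.mpr h)

theorem IsRectangle.exists_lexRank_interval {P : Finset (ℝ × ℝ)} (hP : P.Nonempty)
    {R : Set (ℝ × ℝ)} (hR : IsRectangle R) :
    ∃ (lo hi : ℕ) (J : Set ℝ), lo < P.card ∧ hi < P.card ∧ J.OrdConnected ∧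
      ∀ p ∈ P, p ∈ R ↔ lo ≤ lexRank P p ∧ lexRank P p ≤ hi ∧ p.2 ∈ J := by
  obtain ⟨I, J, hI, hJ, rfl⟩ := hR
  rcases (P.filter fun p => p.1 ∈ I).eq_empty_or_nonempty with h | h
  · refine ⟨0, 0, ∅, hP.card_pos, hP.card_pos, Set.ordConnected_empty, fun p hp => ?_⟩
    have : p.1 ∉ I := fun hpI =>
      Finset.notMem_empty p (h ▸ Finset.mem_filter.mpr ⟨hp, hpI⟩)
    simp [this]
  · obtain ⟨a, ha, hamin⟩ := Finset.exists_min_image _ (lexRank P) h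
    obtain ⟨b, hb, hbmax⟩ := Finset.exists_max_image _ (lexRank P) h
    rw [Finset.mem_filter] at ha hb
    refine ⟨lexRank P a, lexRank P b, J, lexRank_lt_card ha.1, lexRank_lt_card hb.1, hJ,
      fun p hp => ⟨fun hpR => ?_, fun hpR => ?_⟩⟩
    · have hpf : p ∈ P.filter fun p => p.1 ∈ I := Finset.mem_filter.mpr ⟨hp, hpR.1⟩
      exact ⟨hamin p hpf, hbmax p hpf, hpR.2⟩
    · exact ⟨hI.out ha.2 hb.2 ⟨fst_le_fst_of_lexRank_le hp hpR.1,
        fst_le_fst_of_lexRank_le hb.1 hpR.2.1⟩, hpR.2.2⟩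

theorem incidences_le_of_card_le_pow {k B L : ℕ} (hk : 1 ≤ k) {P : Finset (ℝ × ℝ)}
    {T : Finset (Set (ℝ × ℝ))} (hP : P.Nonempty) (hL : P.card ≤ B ^ L)
    (hT : ∀ R ∈ T, IsRectangle R) (hfree : IncidenceKFree k P T) :
    incidences P T ≤ T.card + 4 * k * (L * P.card + B * T.card) := by
  rw [incidences_eq_card_interedges]
  choose! lo hi J hlo hhi hJ hmem using fun R hR => (hT R hR).exists_lexRank_interval hP
  exact card_interedges_le_of_tree hk (lexRank P) Prod.snd lo hi J (lexRank_injOn P)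
    (fun p hp => lexRank_lt_card hp) le_rfl (fun R hR => (hlo R hR).trans_le hL)
    (fun R hR => (hhi R hR).trans_le hL) hJ (fun p hp R hR => hmem R hR p hp) hfree.bicliqueFree

theorem one_lt_log_natCast {n : ℕ} (hn : 3 ≤ n) : 1 < Real.log n := by
  rw [Real.lt_log_iff_exp_lt (by positivity)]
  have : (3 : ℝ) ≤ n := by exact_mod_cast hn
  linarith [Real.exp_one_lt_d9]

/-- A tree with fan-out about `(log n) ^ ε` over `n` leaves has depth
`O(log n / log (log n))`. -/
theorem exists_fanout_depth {ε : ℝ} (hε : 0 < ε) {n : ℕ} (hn : 3 ≤ n) :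
    ∃ B L : ℕ, n ≤ B ^ L ∧ (B : ℝ) ≤ 3 * Real.log n ^ ε ∧
      (L : ℝ) ≤ (1 / ε + 1) * (Real.log n / Real.log (Real.log n)) := by
  have hlog := one_lt_log_natCast hn
  have hloglog : 0 < Real.log (Real.log n) := Real.log_pos hlog
  have hX : 1 ≤ Real.log n ^ ε := Real.one_le_rpow hlog.le hε.le
  set X := Real.log n ^ ε with hXdef
  refine ⟨⌈X⌉₊ + 1, Nat.clog (⌈X⌉₊ + 1) n, ?_, ?_, ?_⟩
  · refine Nat.le_pow_clog ?_ n
    have : 0 < ⌈X⌉₊ := Nat.ceil_pos.mpr (by linarith)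
    omega
  · have := Nat.ceil_lt_add_one (show 0 ≤ X by linarith)
    push_cast
    linarith
  · set b := ⌈X⌉₊ + 1 with hb
    have hb1 : 1 < b := by
      have : 0 < ⌈X⌉₊ := Nat.ceil_pos.mpr (by linarith)
      omega
    have hbX : X ≤ b := by
      have := Nat.le_ceil X
      rw [hb]
      push_cast
      linarith
    have hlogb : ε * Real.log (Real.log n) ≤ Real.log b := by
      rw [← Real.log_rpow (by linarith)]
      exact Real.log_le_log (by linarith) hbX
    have hpow := Nat.pow_pred_clog_lt_self hb1 (by omega : 1 < n)
    have h1 : ((Nat.clog b n).pred : ℝ) * Real.log b ≤ Real.log n := by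
      rw [← Real.log_pow]
      refine Real.log_le_log (by positivity) ?_
      exact_mod_cast hpow.le
    have h2 : ((Nat.clog b n).pred : ℝ) ≤ 1 / ε * (Real.log n / Real.log (Real.log n)) := by
      rw [one_div_mul_eq_div, div_div, le_div_iff₀ (by positivity), mul_comm _ ε]
      exact (mul_le_mul_of_nonneg_left hlogb (Nat.cast_nonneg _)).trans h1
    have h3 : (Nat.clog b n : ℝ) ≤ (Nat.clog b n).pred + 1 := by
      exact_mod_cast (by rw [Nat.pred_eq_sub_one]; omega :
        Nat.clog b n ≤ (Nat.clog b n).pred + 1)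
    have h4 : 1 ≤ Real.log n / Real.log (Real.log n) := by
      rw [one_le_div hloglog]
      exact Real.log_le_self (by linarith)
    linarith

theorem incidences_le {ε : ℝ} (hε : 0 < ε) {k : ℕ} (hk : 1 ≤ k) {P : Finset (ℝ × ℝ)}
    {T : Finset (Set (ℝ × ℝ))} (hP : 3 ≤ P.card) (hT : ∀ R ∈ T, IsRectangle R)
    (hfree : IncidenceKFree k P T) :
    (incidences P T : ℝ) ≤ (4 / ε + 17) *
      ((k : ℝ) * P.card * (Real.log P.card / Real.log (Real.log P.card)) +
        (k : ℝ) * T.card * (Real.log P.card) ^ ε) := by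
  obtain ⟨B, L, hBL, hB, hL⟩ := exists_fanout_depth hε hP
  have hne : P.Nonempty := Finset.card_pos.mp (by omega)
  have h := incidences_le_of_card_le_pow hk hne hBL hT hfree
  have hlog := one_lt_log_natCast hP
  have hX : 1 ≤ Real.log P.card ^ ε := Real.one_le_rpow hlog.le hε.le
  have hΛ : 0 < Real.log P.card / Real.log (Real.log P.card) :=
    div_pos (by linarith) (Real.log_pos hlog)
  set X := Real.log P.card ^ ε
  set Λ := Real.log P.card / Real.log (Real.log P.card)
  have hk' : (1 : ℝ) ≤ k := by exact_mod_cast hk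
  have h' : (incidences P T : ℝ) ≤ T.card + 4 * k * (L * P.card + B * T.card) := by
    exact_mod_cast h
  have hkX : (T.card : ℝ) ≤ k * T.card * X := by
    calc (T.card : ℝ) = 1 * T.card * 1 := by ring
      _ ≤ k * T.card * X := by gcongr
  calc (incidences P T : ℝ) ≤ T.card + 4 * k * (L * P.card + B * T.card) := h'
    _ ≤ k * T.card * X + 4 * k * ((1 / ε + 1) * Λ * P.card + 3 * X * T.card) := by gcongr
    _ = (4 / ε + 4) * (k * P.card * Λ) + 13 * (k * T.card * X) := by ring
    _ ≤ (4 / ε + 17) * (k * P.card * Λ) + (4 / ε + 17) * (k * T.card * X) := by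
        have : 0 ≤ 4 / ε := by positivity
        gcongr <;> linarith
    _ = _ := by ring

end UpperBound

/-! ### Grid lines as rectangles -/

section LowerBound

open scoped Classical

/-- The number whose base-`b` digits are the last `j` digits of `N` in reversed order. -/
def digitRev (b : ℕ) : ℕ → ℕ → ℕ
  | 0, _ => 0
  | j + 1, N => b * digitRev b j N + N / b ^ j % b

theorem digitRev_eq_iff {b : ℕ} (hb : 0 < b) (j N M : ℕ) :
    digitRev b j N = digitRev b j M ↔ N % b ^ j = M % b ^ j := by
  induction j with
  | zero => simp [digitRev, Nat.mod_one]
  | succ j ih =>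
    have hlt : ∀ K, K / b ^ j % b < b := fun K => Nat.mod_lt _ hb
    have hlt' : ∀ K, K % b ^ j < b ^ j := fun K => Nat.mod_lt _ (by positivity)
    rw [digitRev, digitRev, Nat.mod_pow_succ, Nat.mod_pow_succ]
    constructor
    · intro h
      have h1 : digitRev b j N = digitRev b j M := by
        have := congrArg (· / b) h
        simpa [Nat.mul_add_div hb, Nat.div_eq_of_lt (hlt _)] using this
      have h2 : N / b ^ j % b = M / b ^ j % b := by rw [h1] at h; omega
      rw [ih.mp h1, h2]
    · intro h
      have h1 : N % b ^ j = M % b ^ j := by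
        have := congrArg (· % b ^ j) h
        simpa [Nat.add_mul_mod_self_left, Nat.mod_eq_of_lt (hlt' _)] using this
      have h2 : N / b ^ j % b = M / b ^ j % b := by
        rw [h1] at h
        exact Nat.eq_of_mul_eq_mul_left (by positivity : 0 < b ^ j) (by omega)
      rw [ih.mpr h1, h2]

theorem digitRev_add_div {b : ℕ} (hb : 0 < b) (j i N : ℕ) :
    digitRev b (j + i) N / b ^ i = digitRev b j N := by
  induction i with
  | zero => simp
  | succ i ih =>
    rw [← add_assoc, digitRev, pow_succ', ← Nat.div_div_eq_div_mul, Nat.mul_add_div hb,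
      Nat.div_eq_of_lt (Nat.mod_lt _ hb), add_zero, ih]

/-- A closed interval whose natural numbers are the `N` with `N / l = q`. It ends halfway before the
next such interval, so that it is not degenerate for `l = 1`. -/
def blockInterval (l q : ℕ) : Set ℝ := Set.Icc ((l * q : ℕ) : ℝ) ((l * q : ℕ) + (l - 1 / 2 : ℝ))

theorem natCast_mem_blockInterval {l : ℕ} (hl : 0 < l) (q N : ℕ) :
    (N : ℝ) ∈ blockInterval l q ↔ N / l = q := by
  rw [Nat.div_eq_iff hl, blockInterval, Set.mem_Icc, Nat.cast_le]
  constructor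
  · rintro ⟨h1, h2⟩
    have h3 : (N : ℝ) < ((l * q + l : ℕ) : ℝ) := by push_cast at h2 ⊢; linarith
    rw [Nat.cast_lt] at h3
    rw [mul_comm] at h1 h3
    omega
  · rintro ⟨h1, h2⟩
    rw [mul_comm] at h1 h2
    refine ⟨h1, ?_⟩
    have h3 : N + 1 ≤ l * q + l := by omega
    have h4 : ((N + 1 : ℕ) : ℝ) ≤ ((l * q + l : ℕ) : ℝ) := by exact_mod_cast h3
    push_cast at h4 ⊢
    linarith

theorem eq_of_blockInterval_eq {l l' q q' : ℕ} (hl : 0 < l)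
    (h : blockInterval l q = blockInterval l' q') : l = l' := by
  have hl' : (1 : ℝ) ≤ l := by exact_mod_cast hl
  rw [blockInterval, blockInterval, Set.Icc_eq_Icc_iff (by linarith)] at h
  have : (l : ℝ) = l' := by linarith [h.1, h.2]
  exact_mod_cast this

theorem blockInterval_nonempty {l : ℕ} (hl : 0 < l) (q : ℕ) : (blockInterval l q).Nonempty :=
  ⟨((l * q : ℕ) : ℝ), (natCast_mem_blockInterval hl q _).mpr (Nat.mul_div_cancel_left q hl)⟩

/-- The point with ordinate `N` whose abscissa is obtained by reversing the last `r` digits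
of `N`. -/
def gridPoint (b r N : ℕ) : ℝ × ℝ := (digitRev b r N, N)

/-- The rectangle of the grid line in direction `j`: of the points `gridPoint b r N` it contains
those for which the digits of `N` above the `j`-th form `q` and those below the `j`-th are the digits
of `s`. Prescribing the former restricts the ordinate to an interval, and prescribing the latter
restricts the abscissa to an interval. -/
def lineBox (b r j q s : ℕ) : Set (ℝ × ℝ) :=
  blockInterval (b ^ (r - j)) (digitRev b j s) ×ˢ blockInterval (b ^ (j + 1)) q

theorem isClosedRectangle_lineBox {b : ℕ} (hb : 0 < b) (r j q s : ℕ) :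
    IsClosedRectangle (lineBox b r j q s) := by
  have h : ∀ i, (1 : ℝ) ≤ ((b ^ i : ℕ) : ℝ) := fun i => by
    exact_mod_cast Nat.one_le_pow _ _ hb
  exact ⟨_, _, _, _, by linarith [h (r - j)], by linarith [h (j + 1)], rfl⟩

theorem gridPoint_mem_lineBox {b r j : ℕ} (hb : 0 < b) (hj : j ≤ r) (q s N : ℕ) :
    gridPoint b r N ∈ lineBox b r j q s ↔ N / b ^ (j + 1) = q ∧ N % b ^ j = s % b ^ j := by
  have hd : digitRev b r N / b ^ (r - j) = digitRev b j N := by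
    have := digitRev_add_div hb j (r - j) N
    rwa [Nat.add_sub_cancel' hj] at this
  rw [gridPoint, lineBox, Set.mem_prod, natCast_mem_blockInterval (by positivity),
    natCast_mem_blockInterval (by positivity), hd, digitRev_eq_iff hb, and_comm]

theorem lineBox_congr {b : ℕ} (hb : 0 < b) {r j q s s' : ℕ} (h : s % b ^ j = s' % b ^ j) :
    lineBox b r j q s = lineBox b r j q s' := by
  rw [lineBox, lineBox, (digitRev_eq_iff hb j s s').mpr h]

/-- Two lines in different directions share at most one point. -/
theorem eq_of_mem_lineBox_of_lt {b r j j' q s q' s' N M : ℕ} (hb : 0 < b) (hj' : j' ≤ r)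
    (hlt : j < j') (hN : gridPoint b r N ∈ lineBox b r j q s)
    (hM : gridPoint b r M ∈ lineBox b r j q s)
    (hN' : gridPoint b r N ∈ lineBox b r j' q' s')
    (hM' : gridPoint b r M ∈ lineBox b r j' q' s') : N = M := by
  rw [gridPoint_mem_lineBox hb (by omega)] at hN hM hN' hM'
  have hmod : N ≡ M [MOD b ^ (j + 1)] :=
    Nat.ModEq.of_dvd (pow_dvd_pow b hlt) (hN'.2.trans hM'.2.symm)
  rw [← Nat.div_add_mod N (b ^ (j + 1)), ← Nat.div_add_mod M (b ^ (j + 1)), hmod, hN.1, hM.1]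

theorem lineBox_pairwise {b r : ℕ} (hb : 0 < b) {j j' q s q' s' N M : ℕ} (hj : j ≤ r)
    (hj' : j' ≤ r) (hN : gridPoint b r N ∈ lineBox b r j q s)
    (hM : gridPoint b r M ∈ lineBox b r j q s)
    (hN' : gridPoint b r N ∈ lineBox b r j' q' s')
    (hM' : gridPoint b r M ∈ lineBox b r j' q' s') :
    N = M ∨ lineBox b r j q s = lineBox b r j' q' s' := by
  rcases lt_trichotomy j j' with h | rfl | h
  · exact Or.inl (eq_of_mem_lineBox_of_lt hb hj' h hN hM hN' hM')
  · right
    rw [gridPoint_mem_lineBox hb hj] at hN hN'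
    rw [← hN.1, ← hN'.1]
    exact lineBox_congr hb (hN.2.symm.trans hN'.2)
  · exact Or.inl (eq_of_mem_lineBox_of_lt hb hj h hN' hM' hN hM)

/-- The rectangles of all grid lines among the points with index below `t * b ^ r`. -/
noncomputable def lineBoxes (b r t : ℕ) : Finset (Set (ℝ × ℝ)) :=
  (Finset.range r).biUnion fun j =>
    (Finset.range (t * b ^ (r - j - 1)) ×ˢ Finset.range (b ^ j)).image
      fun x => lineBox b r j x.1 x.2

theorem exists_of_mem_lineBoxes {b r t : ℕ} {R : Set (ℝ × ℝ)} (hR : R ∈ lineBoxes b r t) :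
    ∃ j q s, j < r ∧ R = lineBox b r j q s := by
  simp only [lineBoxes, Finset.mem_biUnion, Finset.mem_image, Finset.mem_range] at hR
  obtain ⟨j, hj, x, -, rfl⟩ := hR
  exact ⟨j, x.1, x.2, hj, rfl⟩

theorem card_lineBoxes_le (b r t : ℕ) : (lineBoxes b r t).card ≤ r * (t * b ^ (r - 1)) := by
  refine Finset.card_biUnion_le.trans ((Finset.sum_le_card_nsmul _ _ (t * b ^ (r - 1)) ?_).trans
    (by simp))
  intro j hj
  rw [Finset.mem_range] at hj
  refine Finset.card_image_le.trans ?_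
  rw [Finset.card_product, Finset.card_range, Finset.card_range, mul_assoc, ← pow_add,
    show r - j - 1 + j = r - 1 by omega]

theorem lineBox_mem_lineBoxes {b r t j N : ℕ} (hb : 0 < b) (hj : j < r) (hN : N < t * b ^ r) :
    lineBox b r j (N / b ^ (j + 1)) N ∈ lineBoxes b r t := by
  refine Finset.mem_biUnion.mpr ⟨j, Finset.mem_range.mpr hj, Finset.mem_image.mpr
    ⟨(N / b ^ (j + 1), N % b ^ j), ?_, lineBox_congr hb (Nat.mod_mod _ _)⟩⟩
  rw [Finset.mem_product, Finset.mem_range, Finset.mem_range]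
  refine ⟨?_, Nat.mod_lt _ (by positivity)⟩
  rw [Nat.div_lt_iff_lt_mul (by positivity), mul_assoc, ← pow_add,
    show r - j - 1 + (j + 1) = r by omega]
  exact hN

/-- Each point lies on `r` lines, one in each direction. -/
theorem le_card_lineBoxes_through {b r t N : ℕ} (hb : 0 < b) (hbr : 2 ≤ b ∨ r ≤ 1)
    (hN : N < t * b ^ r) :
    r ≤ ((lineBoxes b r t).filter fun R => gridPoint b r N ∈ R).card := by
  calc r = (Finset.range r).card := (Finset.card_range r).symm
    _ ≤ _ := by
      refine Finset.card_le_card_of_injOn (fun j => lineBox b r j (N / b ^ (j + 1)) N) ?_ ?_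
      · intro j hj
        have hj' : j < r := by simpa using hj
        exact Finset.mem_filter.mpr ⟨lineBox_mem_lineBoxes hb hj' hN,
          (gridPoint_mem_lineBox hb hj'.le _ _ _).mpr ⟨rfl, rfl⟩⟩
      · intro j hj j' hj' h
        simp only [Finset.coe_range, Set.mem_Iio] at hj hj'
        rcases hbr with hb2 | hr
        · change lineBox _ _ _ _ _ = lineBox _ _ _ _ _ at h
          rw [lineBox, lineBox, Set.prod_eq_prod_iff_of_nonempty
            ((blockInterval_nonempty (by positivity) _).prod
              (blockInterval_nonempty (by positivity) _))] at h
          have := Nat.pow_right_injective hb2 (eq_of_blockInterval_eq (by positivity) h.2)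
          omega
        · omega

/-- A rectangle in the left half-plane; it contains no grid point and serves to bring the number of
rectangles up to `n`. -/
def fillerBox (i : ℕ) : Set (ℝ × ℝ) := Set.Icc (-2) (-1) ×ˢ Set.Icc (i : ℝ) (i + 1)

theorem fillerBox_injective : Function.Injective fillerBox := by
  intro i j h
  rw [fillerBox, fillerBox, Set.prod_eq_prod_iff_of_nonempty
    ((Set.nonempty_Icc.mpr (by norm_num)).prod (Set.nonempty_Icc.mpr (by linarith))),
    Set.Icc_eq_Icc_iff (by norm_num : (-2 : ℝ) ≤ -1), Set.Icc_eq_Icc_iff (by linarith)] at h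
  exact_mod_cast h.2.1

theorem gridPoint_notMem_fillerBox (b r N i : ℕ) : gridPoint b r N ∉ fillerBox i := by
  rintro ⟨⟨-, h⟩, -⟩
  have : (0 : ℝ) ≤ (digitRev b r N : ℕ) := Nat.cast_nonneg _
  simp only [gridPoint] at h
  linarith

theorem lineBox_ne_fillerBox {b : ℕ} (hb : 0 < b) (r j q s i : ℕ) :
    lineBox b r j q s ≠ fillerBox i := by
  intro h
  have h1 := (Set.prod_eq_prod_iff_of_nonempty
    ((blockInterval_nonempty (by positivity : 0 < b ^ (r - j)) _).prod
      (blockInterval_nonempty (by positivity : 0 < b ^ (j + 1)) _))).mp h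
  obtain ⟨x, hx⟩ := blockInterval_nonempty (by positivity : 0 < b ^ (r - j)) (digitRev b j s)
  have hx' := hx
  rw [h1.1] at hx'
  have : (0 : ℝ) ≤ ((b ^ (r - j) * digitRev b j s : ℕ) : ℝ) := Nat.cast_nonneg _
  linarith [hx.1, hx'.2]

/-- With as many directions as digits there are as many lines as points. -/
theorem exists_rectangles_of_pow_le {k n b : ℕ} (hk : 2 ≤ k) (hb : 0 < b) (hn : b ^ b ≤ n) :
    ∃ (P : Finset (ℝ × ℝ)) (B : Finset (Set (ℝ × ℝ))),
      P.card = n ∧ B.card = n ∧ (∀ R ∈ B, IsClosedRectangle R) ∧ IncidenceKFree k P B ∧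
        n * b ≤ 2 * incidences P B := by
  have hpos : 0 < b ^ b := by positivity
  set t := n / b ^ b with ht
  have htn : t * b ^ b ≤ n := Nat.div_mul_le_self n _
  have hcard : (lineBoxes b b t).card ≤ n := by
    refine (card_lineBoxes_le b b t).trans (le_trans (le_of_eq ?_) htn)
    rw [mul_left_comm, ← pow_succ', Nat.sub_add_cancel hb]
  have hinj : Function.Injective (gridPoint b b) := by
    intro N M h
    have := congrArg Prod.snd h
    simpa [gridPoint] using this
  refine ⟨(Finset.range n).image (gridPoint b b),
    lineBoxes b b t ∪ (Finset.range (n - (lineBoxes b b t).card)).image fillerBox, ?_, ?_, ?_, ?_,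
    ?_⟩
  · rw [Finset.card_image_of_injective _ hinj, Finset.card_range]
  · rw [Finset.card_union_of_disjoint, Finset.card_image_of_injective _ fillerBox_injective,
      Finset.card_range]
    · omega
    · rw [Finset.disjoint_left]
      intro R hR hR'
      obtain ⟨j, q, s, -, rfl⟩ := exists_of_mem_lineBoxes hR
      obtain ⟨i, -, h⟩ := Finset.mem_image.mp hR'
      exact lineBox_ne_fillerBox hb _ _ _ _ _ h.symm
  · intro R hR
    rcases Finset.mem_union.mp hR with hR | hR
    · obtain ⟨j, q, s, -, rfl⟩ := exists_of_mem_lineBoxes hR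
      exact isClosedRectangle_lineBox hb _ _ _ _
    · obtain ⟨i, -, rfl⟩ := Finset.mem_image.mp hR
      exact ⟨-2, -1, i, i + 1, by norm_num, by linarith, rfl⟩
  · refine incidenceKFree_of_pairwise hk ?_
    intro p hp q hq R hR Q hQ hpR hqR hpQ hqQ
    obtain ⟨N, -, rfl⟩ := Finset.mem_image.mp hp
    obtain ⟨M, -, rfl⟩ := Finset.mem_image.mp hq
    rcases Finset.mem_union.mp hR with hR | hR
    · rcases Finset.mem_union.mp hQ with hQ | hQ
      · obtain ⟨j, q, s, hj, rfl⟩ := exists_of_mem_lineBoxes hR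
        obtain ⟨j', q', s', hj', rfl⟩ := exists_of_mem_lineBoxes hQ
        exact (lineBox_pairwise hb hj.le hj'.le hpR hqR hpQ hqQ).imp_left (congrArg _)
      · obtain ⟨i, -, rfl⟩ := Finset.mem_image.mp hQ
        exact absurd hpQ (gridPoint_notMem_fillerBox _ _ _ _)
    · obtain ⟨i, -, rfl⟩ := Finset.mem_image.mp hR
      exact absurd hpR (gridPoint_notMem_fillerBox _ _ _ _)
  · have hinc : t * b ^ b * b ≤ incidences ((Finset.range n).image (gridPoint b b))
        (lineBoxes b b t ∪ (Finset.range (n - (lineBoxes b b t).card)).image fillerBox) := by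
      rw [incidences_eq_card_interedges]
      calc t * b ^ b * b = ∑ _N ∈ Finset.range (t * b ^ b), b := by simp
        _ ≤ ∑ N ∈ Finset.range (t * b ^ b),
            ((lineBoxes b b t).filter fun R => gridPoint b b N ∈ R).card :=
          Finset.sum_le_sum fun N hN => le_card_lineBoxes_through hb (by omega)
            (Finset.mem_range.mp hN)
        _ = ((Finset.range (t * b ^ b)).sigma fun N =>
            (lineBoxes b b t).filter fun R => gridPoint b b N ∈ R).card :=
          (Finset.card_sigma _ _).symm
        _ ≤ _ := by
          refine Finset.card_le_card_of_injOn (fun x => (gridPoint b b x.1, x.2)) ?_ ?_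
          · rintro ⟨N, R⟩ hx
            simp only [Finset.coe_sigma, Set.mem_sigma_iff, Finset.mem_coe, Finset.mem_range,
              Finset.mem_filter] at hx
            exact Rel.mem_interedges_iff.mpr
              ⟨Finset.mem_image_of_mem _ (Finset.mem_range.mpr (hx.1.trans_le htn)),
                Finset.mem_union_left _ hx.2.1, hx.2.2⟩
          · rintro ⟨N, R⟩ - ⟨M, Q⟩ - h
            simp only [Prod.mk.injEq] at h
            obtain ⟨h1, rfl⟩ := h
            rw [hinj h1]
    have ht1 : 1 ≤ t := (Nat.one_le_div_iff hpos).mpr hn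
    have hn2 : n ≤ 2 * (t * b ^ b) := by
      have h1 := Nat.lt_mul_div_succ n hpos
      rw [← ht, Nat.mul_comm, add_mul] at h1
      have h2 : b ^ b ≤ t * b ^ b := Nat.le_mul_of_pos_left _ ht1
      omega
    calc n * b ≤ 2 * (t * b ^ b) * b := Nat.mul_le_mul_right _ hn2
      _ = 2 * (t * b ^ b * b) := by ring
      _ ≤ _ := Nat.mul_le_mul_left _ hinc

/-- The largest `b` with `b ^ b ≤ n` is of order `log n / log (log n)`. -/
theorem exists_pow_self_le {n : ℕ} (hn : 3 ≤ n) :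
    ∃ b : ℕ, 0 < b ∧ b ^ b ≤ n ∧
      Real.log n / Real.log (Real.log n) ≤ (4 + 4 / Real.log (Real.log 3)) * b := by
  obtain ⟨b, hb1, hbn, hnb⟩ : ∃ b : ℕ, 0 < b ∧ b ^ b ≤ n ∧ n < (b + 1) ^ (b + 1) := by
    have hex : ∃ b : ℕ, n < (b + 1) ^ (b + 1) :=
      ⟨n, (Nat.lt_succ_self n).trans_le (Nat.le_self_pow (by omega) _)⟩
    refine ⟨Nat.find hex, ?_, ?_, Nat.find_spec hex⟩
    · rw [Nat.find_pos]
      omega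
    · have h0 : 0 < Nat.find hex := by
        rw [Nat.find_pos]
        omega
      have := Nat.find_min hex (m := Nat.find hex - 1) (by omega)
      rw [Nat.sub_add_cancel h0] at this
      omega
  refine ⟨b, hb1, hbn, ?_⟩
  have hlog3 : 1 < Real.log ((3 : ℕ) : ℝ) := one_lt_log_natCast le_rfl
  rw [Nat.cast_ofNat] at hlog3
  have hδ : 0 < Real.log (Real.log 3) := Real.log_pos hlog3
  have hn3 : (3 : ℝ) ≤ n := by exact_mod_cast hn
  have hlogn : Real.log 3 ≤ Real.log n := Real.log_le_log (by norm_num) hn3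
  have hδn : Real.log (Real.log 3) ≤ Real.log (Real.log n) :=
    Real.log_le_log (by linarith) hlogn
  have hloglog : 0 < Real.log (Real.log n) := hδ.trans_le hδn
  have hupper : Real.log n ≤ (b + 1) * Real.log (b + 1) := by
    have h : (n : ℝ) ≤ ((b : ℝ) + 1) ^ (b + 1) := by exact_mod_cast hnb.le
    have h' := Real.log_le_log (by linarith) h
    rw [Real.log_pow] at h'
    exact_mod_cast h'
  have hb1' : (1 : ℝ) ≤ b := by exact_mod_cast hb1
  have hlogb : 0 ≤ Real.log ((b : ℝ) + 1) := Real.log_nonneg (by linarith)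
  rw [div_le_iff₀ hloglog]
  rcases Nat.lt_or_ge b 3 with hb3 | hb3
  · have hb2 : (b : ℝ) ≤ 2 := by exact_mod_cast (by omega : b ≤ 2)
    have h1 : Real.log ((b : ℝ) + 1) ≤ 2 := by
      refine (Real.log_le_sub_one_of_pos (by linarith)).trans ?_
      linarith
    calc Real.log n ≤ (b + 1) * Real.log (b + 1) := hupper
      _ ≤ (b + b) * 2 := by gcongr
      _ = 4 * b := by ring
      _ = 4 / Real.log (Real.log 3) * b * Real.log (Real.log 3) := by field_simp
      _ ≤ 4 / Real.log (Real.log 3) * b * Real.log (Real.log n) := by gcongr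
      _ ≤ (4 + 4 / Real.log (Real.log 3)) * b * Real.log (Real.log n) := by
        gcongr
        linarith
  · have hb3' : (3 : ℝ) ≤ b := by exact_mod_cast hb3
    have h1 : (b : ℝ) ≤ Real.log n := by
      have h2 : (b : ℝ) * Real.log b ≤ Real.log n := by
        rw [← Real.log_pow]
        exact Real.log_le_log (by positivity) (by exact_mod_cast hbn)
      have h3 := one_lt_log_natCast hb3
      nlinarith
    have h2 : Real.log b ≤ Real.log (Real.log n) := Real.log_le_log (by linarith) h1
    have h3 : Real.log ((b : ℝ) + 1) ≤ 2 * Real.log b := by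
      have : Real.log ((b : ℝ) ^ 2) = 2 * Real.log b := by
        rw [Real.log_pow]
        norm_num
      rw [← this]
      exact Real.log_le_log (by linarith) (by nlinarith)
    calc Real.log n ≤ (b + 1) * Real.log (b + 1) := hupper
      _ ≤ (b + b) * (2 * Real.log (Real.log n)) := by
        gcongr
        linarith
      _ = 4 * b * Real.log (Real.log n) := by ring
      _ ≤ (4 + 4 / Real.log (Real.log 3)) * b * Real.log (Real.log n) := by
        gcongr
        have : 0 ≤ 4 / Real.log (Real.log 3) := by positivity
        linarith

end LowerBound

/-! ### Both bounds -/

theorem mainTheorem8 :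
    (∀ ε : ℝ, 0 < ε → ∃ C : ℝ, 0 < C ∧
      ∀ k n m : ℕ, 1 ≤ k → 3 ≤ n →
        ∀ (P : Finset (ℝ × ℝ)) (B : Finset (Set (ℝ × ℝ))),
          P.card = n → B.card = m → (∀ R ∈ B, IsRectangle R) → IncidenceKFree k P B →
            (incidences P B : ℝ) ≤
              C * ((k : ℝ) * n * (Real.log n / Real.log (Real.log n)) +
                (k : ℝ) * m * (Real.log n) ^ ε)) ∧
    (∃ c : ℝ, 0 < c ∧
      ∀ k n : ℕ, 2 ≤ k → 3 ≤ n →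
        ∃ (P : Finset (ℝ × ℝ)) (B : Finset (Set (ℝ × ℝ))),
          P.card = n ∧ B.card = n ∧ (∀ R ∈ B, IsClosedRectangle R) ∧ IncidenceKFree k P B ∧
            c * ((n : ℝ) * (Real.log n / Real.log (Real.log n))) ≤ (incidences P B : ℝ)) := by
  refine ⟨fun ε hε => ⟨4 / ε + 17, by positivity, ?_⟩, ?_⟩
  · rintro k n m hk hn P B rfl rfl hB hfree
    exact incidences_le hε hk hn hB hfree
  · have hδ : 0 < Real.log (Real.log 3) :=
      Real.log_pos (by exact_mod_cast one_lt_log_natCast (le_refl 3))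
    have hc : 0 < 4 + 4 / Real.log (Real.log 3) := by positivity
    refine ⟨1 / (2 * (4 + 4 / Real.log (Real.log 3))), by positivity, fun k n hk hn => ?_⟩
    obtain ⟨b, hb, hbn, hΛ⟩ := exists_pow_self_le hn
    obtain ⟨P, B, hP, hB, hrect, hfree, hinc⟩ := exists_rectangles_of_pow_le hk hb hbn
    refine ⟨P, B, hP, hB, hrect, hfree, ?_⟩
    have hinc' : (n : ℝ) * b ≤ 2 * incidences P B := by exact_mod_cast hinc
    rw [one_div, inv_mul_le_iff₀ (by positivity)]
    calc (n : ℝ) * (Real.log n / Real.log (Real.log n))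
        ≤ n * ((4 + 4 / Real.log (Real.log 3)) * b) := by gcongr
      _ = (4 + 4 / Real.log (Real.log 3)) * (n * b) := by ring
      _ ≤ (4 + 4 / Real.log (Real.log 3)) * (2 * incidences P B) := by gcongr
      _ = _ := by ring
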